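/- Let $\mu_1,\mu_2\in[0,1]$, not both in $\{0,1\}$. For even positive integers $N_1,N_2$ let $r_{i,1},\dots,r_{i,N_i}$ ($i=1,2$) be independent Bernoulli random variables, those of arm $i$ having mean $\mu_i$. Split the sample of each arm $i$ at random into a training half and a validation half: the index set $A_i$ of the training half is uniformly distributed over the subsets of $\{1,\dots,N_i\}$ of size $N_i/2$, and $A_1$, $A_2$ and all the rewards are mutually independent. Put \[ \Delta=\frac1{N_1}\sum_{j=1}^{N_1} r_{1,j}-\frac1{N_2}\sum_{j=1}^{N_2} r_{2,j},\qquad \Delta_{tr}=\frac{2}{N_1}\sum_{j\in A_1} r_{1,j}-\frac{2}{N_2}\sum_{j\in A_2} r_{2,j},\qquad \sigma_\Delta^2=\frac{\mu_1(1-\mu_1)}{N_1}+\frac{\mu_2(1-\mu_2)}{N_2}. \] Then $\sigma_\Delta^2$ is the variance of the full-sample difference $\Delta$. Moreover, if $N_1,N_2\to\infty$ with the ratio $N_1/N_2$ held fixed, then \[ \frac{\Delta_{tr}-\Delta}{\sigma_\Delta}\;\xrightarrow{d}\;\mathcal N(0,1). \] -/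

import Mathlib

open MeasureTheory ProbabilityTheory Filter

/-- The average of the entries of `x` whose index lies in `s`. -/
noncomputable def sampleMean {m : ℕ} (x : Fin m → ℝ) (s : Finset (Fin m)) : ℝ :=
  (∑ j ∈ s, x j) / (s.card : ℝ)

/-- The difference of the full-sample means of the two arms, where `x i j` is the `j`-th reward
of arm `i`. -/
noncomputable def fullDiff {N : Fin 2 → ℕ} (x : (i : Fin 2) → Fin (N i) → ℝ) : ℝ :=
  sampleMean (x 0) Finset.univ - sampleMean (x 1) Finset.univ

/-- The difference of the training means of the two arms, where `s i` is the set of indices of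
the training samples of arm `i`. -/
noncomputable def trainDiff {N : Fin 2 → ℕ} (x : (i : Fin 2) → Fin (N i) → ℝ)
    (s : (i : Fin 2) → Finset (Fin (N i))) : ℝ :=
  sampleMean (x 0) (s 0) - sampleMean (x 1) (s 1)

/-- The variance `μ₀ (1 - μ₀) / N₀ + μ₁ (1 - μ₁) / N₁`. -/
noncomputable def sigmaSq (μ : Fin 2 → unitInterval) (N : Fin 2 → ℕ) : ℝ :=
  (μ 0 : ℝ) * (1 - (μ 0 : ℝ)) / (N 0 : ℝ) + (μ 1 : ℝ) * (1 - (μ 1 : ℝ)) / (N 1 : ℝ)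

/-- A random two-armed history with a random even split, on the probability space `(Ω, P)`.
`X i j` is the `j`-th of the `N i` rewards of arm `i`, and `A i` is the set of indices of the
training samples of arm `i`; the complement of `A i` is the validation half. The rewards of arm `i`
are Bernoulli with mean `μ i`, `A i` is uniform among the subsets of size `N i / 2`, and all the
rewards and the two splits are mutually independent. -/
structure IsSplitHistory {Ω : Type*} [MeasurableSpace Ω] (P : Measure Ω)
    (μ : Fin 2 → unitInterval) (N : Fin 2 → ℕ)
    (X : (i : Fin 2) → Fin (N i) → Ω → ℝ)
    (A : (i : Fin 2) → Ω → Finset (Fin (N i))) : Prop where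
  even_size : ∀ i, Even (N i)
  reward_law : ∀ i j, HasLaw (X i j) (bernoulliMeasure (1 : ℝ) 0 (μ i)) P
  split_law : ∀ i, HasLaw (A i) (uniformOn {s : Finset (Fin (N i)) | s.card = N i / 2}) P
  rewards_indep : iIndepFun (fun (p : (i : Fin 2) × Fin (N i)) => X p.1 p.2) P
  splits_indep : IndepFun (A 0) (A 1) P
  rewards_indep_splits :
    IndepFun (fun ω (p : (i : Fin 2) × Fin (N i)) => X p.1 p.2 ω) (fun ω => (A 0 ω, A 1 ω)) P

open scoped Topology

/-! ### Bernoulli characteristic functions and moments. -/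

section Bernoulli

/-! For fixed splits, the error `Δ_tr - Δ` is a sum of independent terms `±r i j / N i`, with each
sign occurring `N i / 2` times in each arm. Opposite signs pair up, so its characteristic function
is the product over the arms of `|φ i (t / N i)| ^ N i`, where `φ i` is that of one reward. This
does not depend on the splits, hence it is also the unconditional one
(`charFun_trainDiff_sub_fullDiff`). After division by `σ`, the fixed ratio makes `N i * σ ^ 2` a
constant `K i`; each factor then has an exponential limit (`tendsto_one_sub_one_sub_cos_pow`), their
product is `exp (-t ^ 2 / 2)`, and Lévy's continuity theorem concludes. -/

lemma charFun_bernoulliMeasure_one_zero (p : unitInterval) (u : ℝ) :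
    charFun (bernoulliMeasure (1 : ℝ) 0 p) u
      = (p : ℝ) * Complex.exp (u * Complex.I) + (1 - (p : ℝ)) := by
  rw [charFun_apply_real, integral_bernoulliMeasure]
  simp

/-- The two factors are complex conjugates, so this is a squared modulus. -/
lemma charFun_bernoulliMeasure_mul_charFun_neg (p : unitInterval) (u : ℝ) :
    charFun (bernoulliMeasure (1 : ℝ) 0 p) u * charFun (bernoulliMeasure (1 : ℝ) 0 p) (-u)
      = ((1 - 2 * ((p : ℝ) * (1 - p)) * (1 - Real.cos u) : ℝ) : ℂ) := by
  simp only [charFun_bernoulliMeasure_one_zero]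
  have h1 : Complex.exp (u * Complex.I) = Complex.cos u + Complex.sin u * Complex.I :=
    Complex.exp_mul_I _
  have h2 : Complex.exp (((-u : ℝ) : ℂ) * Complex.I) = Complex.cos u - Complex.sin u * Complex.I := by
    rw [Complex.exp_mul_I]
    push_cast
    rw [Complex.cos_neg, Complex.sin_neg]
    ring
  rw [h1, h2]
  push_cast
  linear_combination ((p : ℝ) : ℂ) ^ 2 * Complex.sin_sq_add_cos_sq (u : ℂ)
    - ((p : ℝ) : ℂ) ^ 2 * Complex.sin (u : ℂ) ^ 2 * Complex.I_sq

lemma memLp_two_of_hasLaw_bernoulliMeasure {Ω : Type*} [MeasurableSpace Ω] {P : Measure Ω}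
    {Y : Ω → ℝ} {a b : ℝ} {p : unitInterval} (h : HasLaw Y (bernoulliMeasure a b p) P) :
    MemLp Y 2 P := by
  have : MemLp id 2 (P.map Y) := by
    rw [h.map_eq, memLp_two_iff_integrable_sq (by fun_prop)]
    exact integrable_bernoulliMeasure _ _ _ _
  exact this.comp_of_map h.aemeasurable

lemma variance_bernoulliMeasure_one_zero (p : unitInterval) :
    variance id (bernoulliMeasure (1 : ℝ) 0 p) = (p : ℝ) * (1 - p) := by
  rw [variance_eq_integral (by fun_prop), integral_bernoulliMeasure, integral_bernoulliMeasure]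
  simp
  ring

end Bernoulli

section Independence

variable {Ω E F : Type*} [MeasurableSpace Ω] [MeasurableSpace E] [MeasurableSpace F]
  {P : Measure Ω} [IsProbabilityMeasure P]

/-- If the characteristic function of `G (X, y)` at `t` does not depend on the value `y` of a
variable `Y` independent of `X`, then it is the characteristic function of `G (X, Y)` at `t`. -/
lemma charFun_map_of_indepFun_of_ae_eq {X : Ω → E} {Y : Ω → F} (hX : AEMeasurable X P)
    (hY : AEMeasurable Y P) (hXY : IndepFun X Y P) {G : E × F → ℝ} (hG : Measurable G) {t : ℝ}
    {z : ℂ} (h : ∀ᵐ ω ∂P, charFun (P.map (fun ω' => G (X ω', Y ω))) t = z) :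
    charFun (P.map (fun ω => G (X ω, Y ω))) t = z := by
  have : IsProbabilityMeasure (P.map X) := Measure.isProbabilityMeasure_map hX
  have : IsProbabilityMeasure (P.map Y) := Measure.isProbabilityMeasure_map hY
  have hmeas : Measurable fun q : E × F => Complex.exp (t * G q * Complex.I) := by fun_prop
  have hslice : ∀ y, charFun (P.map (fun ω' => G (X ω', y))) t
      = ∫ x, Complex.exp (t * G (x, y) * Complex.I) ∂(P.map X) := by
    intro y
    have hGy : AEMeasurable (fun ω' => G (X ω', y)) P :=
      (hG.comp measurable_prodMk_right).comp_aemeasurable hX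
    rw [charFun_apply_real, integral_map hGy (by fun_prop),
      integral_map hX]
    exact (hmeas.comp measurable_prodMk_right).aestronglyMeasurable
  simp_rw [hslice] at h
  have hsm : StronglyMeasurable
      fun y => ∫ x, Complex.exp (t * G (x, y) * Complex.I) ∂(P.map X) :=
    hmeas.stronglyMeasurable.integral_prod_left'
  have h' : ∀ᵐ y ∂(P.map Y), ∫ x, Complex.exp (t * G (x, y) * Complex.I) ∂(P.map X) = z :=
    (ae_map_iff hY (hsm.measurable (measurableSet_singleton z))).2 h
  have hGXY : AEMeasurable (fun ω => G (X ω, Y ω)) P := hG.comp_aemeasurable (hX.prodMk hY)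
  rw [charFun_apply_real, integral_map hGXY (by fun_prop),
    ← integral_map (f := fun q : E × F => Complex.exp (t * G q * Complex.I)) (hX.prodMk hY)
      hmeas.aestronglyMeasurable,
    (indepFun_iff_map_prod_eq_prod_map_map hX hY).1 hXY, integral_prod_symm, integral_congr_ae h']
  · simp
  · refine Integrable.of_bound hmeas.aestronglyMeasurable 1 (ae_of_all _ fun q => ?_)
    rw [← Complex.ofReal_mul, Complex.norm_exp_ofReal_mul_I]

end Independence

/-! ### The split error as a balanced signed sum. -/

section Split

lemma sampleMean_univ {m : ℕ} (x : Fin m → ℝ) :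
    sampleMean x Finset.univ = ∑ j, (m : ℝ)⁻¹ * x j := by
  simp [sampleMean, div_eq_inv_mul, Finset.mul_sum]

/-- A training index has weight `2 / m - 1 / m`, any other `0 - 1 / m`. -/
lemma sampleMean_sub_sampleMean_univ {m : ℕ} (hm : Even m) (x : Fin m → ℝ) {s : Finset (Fin m)}
    (hs : s.card = m / 2) :
    sampleMean x s - sampleMean x Finset.univ
      = ∑ j, (if j ∈ s then (m : ℝ)⁻¹ else -(m : ℝ)⁻¹) * x j := by
  obtain ⟨n, rfl⟩ := hm
  have hn : s.card = n := by omega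
  have h1 : sampleMean x s = ∑ j, if j ∈ s then 2 * ((n + n : ℕ) : ℝ)⁻¹ * x j else 0 := by
    rw [sampleMean, hn, ← Finset.sum_filter, Finset.filter_mem_eq_inter, Finset.univ_inter,
      ← Finset.mul_sum, div_eq_inv_mul]
    congr 1
    push_cast
    rw [← two_mul, mul_inv]
    ring
  rw [h1, sampleMean_univ, ← Finset.sum_sub_distrib]
  refine Finset.sum_congr rfl fun j _ => ?_
  split_ifs <;> ring

lemma prod_charFun_bernoulliMeasure_split {m : ℕ} (hm : Even m) (p : unitInterval)
    {s : Finset (Fin m)} (hs : s.card = m / 2) (u : ℝ) :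
    ∏ j, charFun (bernoulliMeasure (1 : ℝ) 0 p) (if j ∈ s then u else -u)
      = (((1 - 2 * ((p : ℝ) * (1 - p)) * (1 - Real.cos u)) ^ (m / 2) : ℝ) : ℂ) := by
  have hc : sᶜ.card = m / 2 := by
    rw [Finset.card_compl, Fintype.card_fin, hs]
    obtain ⟨n, rfl⟩ := hm
    omega
  rw [← Finset.prod_mul_prod_compl s,
    Finset.prod_congr rfl (g := fun _ => charFun (bernoulliMeasure (1 : ℝ) 0 p) u)
      fun j hj => by rw [if_pos hj],
    Finset.prod_congr (s₁ := sᶜ) rfl (g := fun _ => charFun (bernoulliMeasure (1 : ℝ) 0 p) (-u))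
      fun j hj => by rw [if_neg (Finset.mem_compl.1 hj)],
    Finset.prod_const, Finset.prod_const, hs, hc, ← mul_pow,
    charFun_bernoulliMeasure_mul_charFun_neg, Complex.ofReal_pow]

variable {Ω : Type*} [MeasurableSpace Ω] {P : Measure Ω}
  {μ : Fin 2 → unitInterval} {N : Fin 2 → ℕ}
  {X : (i : Fin 2) → Fin (N i) → Ω → ℝ} {A : (i : Fin 2) → Ω → Finset (Fin (N i))}

namespace IsSplitHistory

lemma ae_card_eq (h : IsSplitHistory P μ N X A) (i : Fin 2) :
    ∀ᵐ ω ∂P, (A i ω).card = N i / 2 := by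
  refine ae_of_ae_map (p := fun s : Finset (Fin (N i)) => s.card = N i / 2)
    (h.split_law i).aemeasurable ?_
  rw [(h.split_law i).map_eq]
  exact ae_cond_mem (Set.toFinite _).measurableSet

lemma charFun_weighted_sum [IsProbabilityMeasure P] (h : IsSplitHistory P μ N X A)
    (w : (i : Fin 2) → Fin (N i) → ℝ) (t : ℝ) :
    charFun (P.map fun ω => ∑ i, ∑ j, w i j * X i j ω) t
      = ∏ i, ∏ j, charFun (bernoulliMeasure (1 : ℝ) 0 (μ i)) (w i j * t) := by
  have hind : iIndepFun (fun (p : (i : Fin 2) × Fin (N i)) ω => w p.1 p.2 * X p.1 p.2 ω) P :=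
    h.rewards_indep.comp (fun p x => w p.1 p.2 * x) fun p => by fun_prop
  have hsum : (fun ω => ∑ i, ∑ j, w i j * X i j ω)
      = fun ω => ∑ p : (i : Fin 2) × Fin (N i), w p.1 p.2 * X p.1 p.2 ω := by
    ext ω
    rw [Fintype.sum_sigma]
  have hmeas : ∀ p : (i : Fin 2) × Fin (N i), AEMeasurable (fun ω => w p.1 p.2 * X p.1 p.2 ω) P :=
    fun p => (h.reward_law p.1 p.2).aemeasurable.const_mul _
  rw [hsum, hind.charFun_map_fun_sum_eq_prod hmeas, Finset.prod_apply,
    Fintype.prod_sigma]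
  refine Finset.prod_congr rfl fun i _ => Finset.prod_congr rfl fun j _ => ?_
  rw [charFun_map_mul_comp (h.reward_law i j).aemeasurable, (h.reward_law i j).map_eq]

theorem variance_fullDiff [IsProbabilityMeasure P] (h : IsSplitHistory P μ N X A) :
    variance (fun ω => fullDiff (fun i j => X i j ω)) P = sigmaSq μ N := by
  have hmem : ∀ i j, MemLp (X i j) 2 P :=
    fun i j => memLp_two_of_hasLaw_bernoulliMeasure (h.reward_law i j)
  let w : Fin 2 → ℝ := ![(N 0 : ℝ)⁻¹, -(N 1 : ℝ)⁻¹]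
  have hsum : (fun ω => fullDiff (fun i j => X i j ω))
      = ∑ p : (i : Fin 2) × Fin (N i), fun ω => w p.1 * X p.1 p.2 ω := by
    ext ω
    simp [fullDiff, sampleMean_univ, Finset.sum_apply, Fintype.sum_sigma, w, Fin.sum_univ_two,
      sub_eq_add_neg]
  have hind : iIndepFun (fun (p : (i : Fin 2) × Fin (N i)) ω => w p.1 * X p.1 p.2 ω) P :=
    h.rewards_indep.comp (fun p x => w p.1 * x) fun p => by fun_prop
  rw [hsum, IndepFun.variance_sum (fun p _ => (hmem p.1 p.2).const_mul _)
    fun p _ q _ hpq => hind.indepFun hpq, Fintype.sum_sigma]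
  have hvar : ∀ i j, variance (X i j) P = (μ i : ℝ) * (1 - μ i) := fun i j => by
    rw [(h.reward_law i j).variance_eq, variance_bernoulliMeasure_one_zero]
  -- An empty arm is allowed here: division by zero gives zero on both sides.
  have hscale : ∀ (n : ℕ) (v : ℝ), (n : ℝ) * ((n : ℝ)⁻¹ ^ 2 * v) = v / n := fun n v => by
    rcases eq_or_ne (n : ℝ) 0 with hn | hn
    · simp [hn]
    · field_simp
  simp_rw [variance_const_mul, hvar]
  simp [w, Fin.sum_univ_two, sigmaSq]
  simpa using congrArg₂ (· + ·) (hscale (N 0) _) (hscale (N 1) _)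

lemma aemeasurable_rewards (h : IsSplitHistory P μ N X A) :
    AEMeasurable (fun ω (p : (i : Fin 2) × Fin (N i)) => X p.1 p.2 ω) P :=
  aemeasurable_pi_lambda _ fun p => (h.reward_law p.1 p.2).aemeasurable

lemma aemeasurable_splits (h : IsSplitHistory P μ N X A) :
    AEMeasurable (fun ω => (A 0 ω, A 1 ω)) P :=
  (h.split_law 0).aemeasurable.prodMk (h.split_law 1).aemeasurable

end IsSplitHistory

/-- The difference between `trainDiff` and `fullDiff` as a function of all rewards and splits. -/
noncomputable def splitError (N : Fin 2 → ℕ)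
    (q : (((i : Fin 2) × Fin (N i)) → ℝ) × (Finset (Fin (N 0)) × Finset (Fin (N 1)))) : ℝ :=
  (sampleMean (fun j => q.1 ⟨0, j⟩) q.2.1 - sampleMean (fun j => q.1 ⟨1, j⟩) q.2.2)
    - fullDiff (fun i j => q.1 ⟨i, j⟩)

lemma measurable_splitError (N : Fin 2 → ℕ) : Measurable (splitError N) := by
  -- Splits take finitely many values, so measurability in the rewards for each fixed split
  -- suffices.
  refine measurable_from_prod_countable_left fun a => ?_
  simp only [splitError, fullDiff, sampleMean]
  fun_prop

namespace IsSplitHistory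

lemma aemeasurable_trainDiff_sub_fullDiff (h : IsSplitHistory P μ N X A) :
    AEMeasurable (fun ω => trainDiff (fun i j => X i j ω) (fun i => A i ω)
      - fullDiff (fun i j => X i j ω)) P := by
  have hcomp := (measurable_splitError N).comp_aemeasurable
    (h.aemeasurable_rewards.prodMk h.aemeasurable_splits)
  exact hcomp

theorem charFun_trainDiff_sub_fullDiff [IsProbabilityMeasure P] (h : IsSplitHistory P μ N X A)
    (t : ℝ) :
    charFun (P.map fun ω => trainDiff (fun i j => X i j ω) (fun i => A i ω)
        - fullDiff (fun i j => X i j ω)) t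
      = ((∏ i, (1 - 2 * ((μ i : ℝ) * (1 - μ i)) * (1 - Real.cos (t / N i))) ^ (N i / 2) : ℝ) : ℂ)
      := by
  refine charFun_map_of_indepFun_of_ae_eq h.aemeasurable_rewards h.aemeasurable_splits
    h.rewards_indep_splits (measurable_splitError N) ?_
  filter_upwards [h.ae_card_eq 0, h.ae_card_eq 1] with ω h0 h1
  let w : (i : Fin 2) → Fin (N i) → ℝ := fun i j =>
    if i = 0 then (if j ∈ A i ω then (N i : ℝ)⁻¹ else -(N i : ℝ)⁻¹)
    else -(if j ∈ A i ω then (N i : ℝ)⁻¹ else -(N i : ℝ)⁻¹)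
  have hsum : ∀ ω', splitError N (fun p => X p.1 p.2 ω', (A 0 ω, A 1 ω))
      = ∑ i, ∑ j, w i j * X i j ω' := fun ω' => by
    have e0 := sampleMean_sub_sampleMean_univ (h.even_size 0) (fun j => X 0 j ω') h0
    have e1 := sampleMean_sub_sampleMean_univ (h.even_size 1) (fun j => X 1 j ω') h1
    simp only [Fin.sum_univ_two, w, if_true, one_ne_zero, if_false, neg_mul,
      Finset.sum_neg_distrib, ← e0, ← e1, splitError, fullDiff]
    ring
  simp_rw [hsum]
  rw [h.charFun_weighted_sum, Fin.prod_univ_two, Fin.prod_univ_two, Complex.ofReal_mul,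
    ← prod_charFun_bernoulliMeasure_split (h.even_size 0) (μ 0) h0,
    -- Arm 1 enters with a minus sign, which the even cosine absorbs.
    ← Real.cos_neg (t / N 1), ← prod_charFun_bernoulliMeasure_split (h.even_size 1) (μ 1) h1]
  congr 1 <;> refine Finset.prod_congr rfl fun j _ => ?_ <;> congr 1 <;> simp only [w] <;>
    split_ifs <;> first | contradiction | (field_simp)

end IsSplitHistory

end Split

/-! ### Limit of the factor of one arm. -/

section Limit

/-- Continuity of `sinc` at `0` replaces a Taylor estimate of the cosine. -/
lemma one_sub_cos_eq_sinc (x : ℝ) : 1 - Real.cos x = x ^ 2 / 2 * Real.sinc (x / 2) ^ 2 := by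
  rcases eq_or_ne x 0 with rfl | hx
  · simp
  · rw [Real.sinc_of_ne_zero (by positivity)]
    have h : Real.cos x = 1 - 2 * Real.sin (x / 2) ^ 2 := by
      rw [← Real.cos_sq_add_sin_sq (x / 2), show x = 2 * (x / 2) by ring, Real.cos_two_mul]
      rw [show 2 * (x / 2) / 2 = x / 2 by ring]
      nlinarith [Real.cos_sq_add_sin_sq (x / 2)]
    rw [h]
    field_simp
    ring

/-- Here `n` stands for `N i / 2`, so `√(2 * n * K)` is `σ * N i`. -/
lemma tendsto_one_sub_one_sub_cos_pow (v t : ℝ) {K : ℝ} (hK : 0 < K) :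
    Tendsto (fun n : ℕ => (1 - 2 * v * (1 - Real.cos (t / √(2 * n * K)))) ^ n) atTop
      (𝓝 (Real.exp (-(v * t ^ 2 / (2 * K))))) := by
  simp_rw [sub_eq_add_neg (1 : ℝ) (2 * v * _)]
  refine Real.tendsto_one_add_pow_exp_of_tendsto ?_
  have hx : Tendsto (fun n : ℕ => t / √(2 * n * K) / 2) atTop (𝓝 0) := by
    have h1 : Tendsto (fun n : ℕ => √(2 * n * K)) atTop atTop :=
      Real.tendsto_sqrt_atTop.comp
        ((tendsto_natCast_atTop_atTop.const_mul_atTop two_pos).atTop_mul_const hK)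
    simpa using (h1.const_div_atTop t).div_const 2
  have hs : Tendsto (fun n : ℕ => -(v * t ^ 2 / (2 * K))
      * Real.sinc (t / √(2 * n * K) / 2) ^ 2) atTop (𝓝 (-(v * t ^ 2 / (2 * K)) * 1 ^ 2)) := by
    have := (Real.continuous_sinc.tendsto 0).comp hx
    rw [Real.sinc_zero] at this
    exact (this.pow 2).const_mul _
  rw [one_pow, mul_one] at hs
  refine hs.congr' ?_
  filter_upwards [eventually_gt_atTop 0] with n hn
  have hn' : (0 : ℝ) < n := by exact_mod_cast hn
  rw [one_sub_cos_eq_sinc, div_pow, Real.sq_sqrt (by positivity)]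
  field_simp

end Limit

theorem theorem1
    (μ : Fin 2 → unitInterval) (hμ : ∃ i, 0 < (μ i : ℝ) ∧ (μ i : ℝ) < 1)
    (N : ℕ → Fin 2 → ℕ) (c : ℝ)
    (hratio : ∀ k, (N k 0 : ℝ) / (N k 1 : ℝ) = c)
    (hN : ∀ i, Tendsto (fun k => N k i) atTop atTop)
    {Ω : ℕ → Type*} [∀ k, MeasurableSpace (Ω k)]
    (P : (k : ℕ) → Measure (Ω k)) [∀ k, IsProbabilityMeasure (P k)]
    (X : (k : ℕ) → (i : Fin 2) → Fin (N k i) → Ω k → ℝ)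
    (A : (k : ℕ) → (i : Fin 2) → Ω k → Finset (Fin (N k i)))
    (hXA : ∀ k, IsSplitHistory (P k) μ (N k) (X k) (A k)) :
    (∀ k, variance (fun ω => fullDiff (fun i j => X k i j ω)) (P k) = sigmaSq μ (N k)) ∧
    TendstoInDistribution
      (fun k ω =>
        (trainDiff (fun i j => X k i j ω) (fun i => A k i ω) - fullDiff (fun i j => X k i j ω))
          / Real.sqrt (sigmaSq μ (N k)))
      atTop (id : ℝ → ℝ) P (gaussianReal 0 1) := by
  refine ⟨fun k => (hXA k).variance_fullDiff, ?_⟩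
  set v : Fin 2 → ℝ := fun i => (μ i : ℝ) * (1 - μ i) with hv
  have hv0 : ∀ i, 0 ≤ v i := fun i => mul_nonneg (μ i).2.1 (sub_nonneg.2 (μ i).2.2)
  have hpos : ∀ᶠ k in atTop, 0 < N k 0 ∧ 0 < N k 1 :=
    ((hN 0).eventually_gt_atTop 0).and ((hN 1).eventually_gt_atTop 0)
  have hc : 0 < c := by
    obtain ⟨k, h0, h1⟩ := hpos.exists
    rw [← hratio k]
    positivity
  have hS : 0 < v 0 + v 1 * c := by
    obtain ⟨i, hi0, hi1⟩ := hμ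
    have hi : 0 < v i := mul_pos hi0 (sub_pos.2 hi1)
    fin_cases i
    · exact add_pos_of_pos_of_nonneg hi (mul_nonneg (hv0 1) hc.le)
    · exact add_pos_of_nonneg_of_pos (hv0 0) (mul_pos hi hc)
  -- `K i` is the constant value of `N k i * sigmaSq μ (N k)`
  let K : Fin 2 → ℝ := ![v 0 + v 1 * c, (v 0 + v 1 * c) / c]
  have hK : ∀ i, 0 < K i := by
    intro i
    fin_cases i
    · exact hS
    · exact div_pos hS hc
  -- `v i / K i` is the share of arm `i` in the variance `σ ^ 2`.
  have hKsum : v 0 / K 0 + v 1 / K 1 = 1 := by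
    simp only [K, Matrix.cons_val_zero, Matrix.cons_val_one]
    field_simp
  have hsigma : ∀ᶠ k in atTop, ∀ i, (N k i : ℝ) * sigmaSq μ (N k) = K i := by
    filter_upwards [hpos] with k ⟨h0, h1⟩
    have h0' : (0 : ℝ) < N k 0 := by exact_mod_cast h0
    have h1' : (0 : ℝ) < N k 1 := by exact_mod_cast h1
    intro i
    fin_cases i
    · simp only [K, sigmaSq, ← hratio k, hv, Matrix.cons_val_zero, Fin.zero_eta]
      field_simp
    · simp only [K, sigmaSq, ← hratio k, hv, Matrix.cons_val_one, Matrix.cons_val_zero, Fin.mk_one]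
      field_simp
  have hmeas : ∀ k, AEMeasurable (fun ω =>
      (trainDiff (fun i j => X k i j ω) (fun i => A k i ω) - fullDiff (fun i j => X k i j ω))
        / Real.sqrt (sigmaSq μ (N k))) (P k) :=
    fun k => (hXA k).aemeasurable_trainDiff_sub_fullDiff.div_const _
  refine ⟨hmeas, aemeasurable_id, ?_⟩
  refine ProbabilityMeasure.tendsto_of_tendsto_charFun fun t => ?_
  simp only [ProbabilityMeasure.coe_mk, Measure.map_id, charFun_gaussianReal]
  have hfac : ∀ i, Tendsto
      (fun k => (1 - 2 * v i * (1 - Real.cos (t / √(2 * (N k i / 2 : ℕ) * K i)))) ^ (N k i / 2))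
      atTop (𝓝 (Real.exp (-(v i * t ^ 2 / (2 * K i))))) := fun i =>
    (tendsto_one_sub_one_sub_cos_pow (v i) t (hK i)).comp
      ((Nat.tendsto_div_const_atTop two_ne_zero).comp (hN i))
  have hlim : ∏ i, Real.exp (-(v i * t ^ 2 / (2 * K i))) = Real.exp (-(t ^ 2 / 2)) := by
    rw [Fin.prod_univ_two, ← Real.exp_add]
    congr 1
    linear_combination (-(t ^ 2 / 2)) * hKsum
  have hprod := tendsto_finsetProd Finset.univ fun i _ => hfac i
  rw [hlim] at hprod
  have hprod' := (Complex.continuous_ofReal.tendsto _).comp hprod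
  have hexp : ((Real.exp (-(t ^ 2 / 2)) : ℝ) : ℂ)
      = Complex.exp (t * (0 : ℝ) * Complex.I - ((1 : NNReal) : ℝ) * t ^ 2 / 2) := by
    push_cast
    congr 1
    simp
  rw [hexp] at hprod'
  refine hprod'.congr' ?_
  filter_upwards [hsigma] with k hk
  simp_rw [Function.comp_apply, div_eq_inv_mul (_ - _) (√_)]
  rw [charFun_map_mul_comp (hXA k).aemeasurable_trainDiff_sub_fullDiff,
    (hXA k).charFun_trainDiff_sub_fullDiff]
  congr 1
  refine Finset.prod_congr rfl fun i _ => ?_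
  have hhalf : 2 * ((N k i / 2 : ℕ) : ℝ) = N k i := by
    exact_mod_cast Nat.two_mul_div_two_of_even ((hXA k).even_size i)
  have hNi : (0 : ℝ) < N k i := by
    refine (Nat.cast_nonneg _).lt_of_ne fun h => (hK i).ne' ?_
    rw [← hk i, ← h, zero_mul]
  have harg : √(2 * ((N k i / 2 : ℕ) : ℝ) * K i) = √(sigmaSq μ (N k)) * N k i := by
    rw [hhalf, ← hk i, show (N k i : ℝ) * (N k i * sigmaSq μ (N k))
      = (N k i : ℝ) ^ 2 * sigmaSq μ (N k) by ring, Real.sqrt_mul (by positivity),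
      Real.sqrt_sq hNi.le, mul_comm]
  rw [harg, ← div_div, div_eq_inv_mul t]
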